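/- Darboux transformation for the two dimensional elliptic $A_{2l}^{(2)}$ Toda equation. Let $l\ge 1$, $N=2l+1$, and let $U\subset\mathbb R^2$ be open. Put $z=(x+\mathrm i y)/2$, $\bar z=(x-\mathrm i y)/2$, so that $\partial_z=\partial_x-\mathrm i\partial_y$, $\partial_{\bar z}=\partial_x+\mathrm i\partial_y$ and $\triangle=\partial_z\partial_{\bar z}=\partial_x^2+\partial_y^2$. Subscripts of $h$, $\gamma$, $g$ and of matrices are read modulo $N$, and $\{k\}\in\{0,\dots,N-1\}$ denotes the remainder of the integer $k$ modulo $N$. Let $(u_1,\dots,u_l)$ be a real $C^2$ solution on $U$ of $$\triangle u_1=e^{u_1}-e^{u_2-u_1},\qquad \triangle u_j=e^{u_j-u_{j-1}}-e^{u_{j+1}-u_j}\ (2\le j\le l-1),\qquad \triangle u_l=e^{u_l-u_{l-1}}-e^{-2u_l}$$ if $l\ge2$, and of $\triangle u_1=e^{u_1}-e^{-2u_1}$ if $l=1$. Let $V$ be the $N\times N$ diagonal matrix with $V_{11}=1$, $V_{j+1,j+1}=e^{u_j}$, $V_{2l+2-j,2l+2-j}=e^{-u_j}$ $(1\le j\le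 l)$, and let $J_{jk}=1$ if $k\equiv j+1 \pmod N$ and $J_{jk}=0$ otherwise. Let $\mu\in\mathbb C$ with $\mu\neq0$, $|\mu|\neq1$, and let $h=(h_1,\dots,h_{2l+1})^T$ be a (real-differentiable, complex-valued) column solution on $U$ of the Lax pair with spectral parameter $\mu$, $$h_z=(\mu J+V_zV^{-1})h,\qquad h_{\bar z}=\mu^{-1}VJ^TV^{-1}h .$$ Define $$\gamma_j=\frac1{1+|\mu|^{4l+2}}\Big((-|\mu|^2)^{\{j-1\}}|h_1|^2+\sum_{c=1}^l(-|\mu|^2)^{\{j+c-1\}}|h_{1+c}|^2e^{-u_c}+\sum_{c=1}^l(-|\mu|^2)^{\{j-c-1\}}|h_{1-c}|^2e^{u_c}\Big),$$ $$g_j=\frac14\Big|\sum_{c=1}^{2l+1}(-1)^{\{c-j\}}h_{2-c}h_c\Big|^2-|\mu|^2\gamma_{j-1}\gamma_{2-j}.$$ Suppose that on $U$ the functions $g_2,\dots,g_{l+2}$ have no zeros and the quotients $g_{j+2}/g_{j+1}$ $(1\le j\le l)$ are positive. Then $$\widetilde u_j=u_j+\ln\frac{g_{j+2}}{g_{j+1}}\qquad(1\le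 j\le l)$$ is again a $C^2$ solution on $U$ of the same Toda equation. -/

import Mathlib

namespace EllipticToda

noncomputable section

/-! The plane with Cartesian coordinates `(x, y)` is the real vector space `ℂ`, with points
`x + i y`. The complex coordinates are `z = (x + i y) / 2` and `z̄ = (x - i y) / 2`, so that
`∂_z = ∂_x - i ∂_y`, `∂_z̄ = ∂_x + i ∂_y` and `∂_z ∂_z̄ = ∂_x² + ∂_y²`. -/

/-- The derivative `∂_z f = ∂_x f - i ∂_y f`. -/
def dz (f : ℂ → ℂ) (p : ℂ) : ℂ :=
  fderiv ℝ f p 1 - Complex.I * fderiv ℝ f p Complex.I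

/-- The derivative `∂_z̄ f = ∂_x f + i ∂_y f`. -/
def dzbar (f : ℂ → ℂ) (p : ℂ) : ℂ :=
  fderiv ℝ f p 1 + Complex.I * fderiv ℝ f p Complex.I

/-- `(u 1, …, u l)` is a classical (`C²`) solution on `U` of the two dimensional elliptic
`A_{2l}^{(2)}` Toda equation
`Δ u_j = exp (u_j - u_{j-1}) - exp (u_{j+1} - u_j)`, `1 ≤ j ≤ l`,
where for `j = 1` the first exponential is `exp u_1`
and for `j = l` the second exponential is `exp (-2 u_l)`.
Only the components `u j` with `1 ≤ j ≤ l` are used. -/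
def IsTodaSolution (l : ℕ) (u : ℕ → ℂ → ℝ) (U : Set ℂ) : Prop :=
  ∀ j ∈ Finset.Icc 1 l, ContDiffOn ℝ 2 (u j) U ∧
    ∀ p ∈ U, Laplacian.laplacian (u j) p =
      (if j = 1 then Real.exp (u 1 p) else Real.exp (u j p - u (j - 1) p))
        - (if j = l then Real.exp (-2 * u l p) else Real.exp (u (j + 1) p - u j p))

/-! Rows and columns of the Lax matrices are indexed by the residues modulo `2l + 1`. -/

/-- The exponents of the diagonal matrix `V`: the exponent with index `1` is `0`, the one with
index `1 + j` is `u_j` and the one with index `1 - j` (that is, `2l + 2 - j`) is `-u_j`,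
for `1 ≤ j ≤ l`. -/
def expo (l : ℕ) (u : ℕ → ℂ → ℝ) (k : ZMod (2 * l + 1)) (p : ℂ) : ℝ :=
  if (k - 1).val = 0 then 0
  else if (k - 1).val ≤ l then u (k - 1).val p
  else -u (2 * l + 1 - (k - 1).val) p

/-- The diagonal matrix `V` of the Lax pair. -/
def matV (l : ℕ) (u : ℕ → ℂ → ℝ) (p : ℂ) :
    Matrix (ZMod (2 * l + 1)) (ZMod (2 * l + 1)) ℂ :=
  Matrix.diagonal fun k => (Real.exp (expo l u k p) : ℂ)

/-- The cyclic shift matrix `J`, `J_{jk} = δ_{j+1,k}` with indices modulo `2l + 1`. -/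
def matJ (l : ℕ) : Matrix (ZMod (2 * l + 1)) (ZMod (2 * l + 1)) ℂ :=
  Matrix.of fun j k => if j + 1 = k then 1 else 0

/-- The matrix `P = V_z V⁻¹`. -/
def matP (l : ℕ) (u : ℕ → ℂ → ℝ) (p : ℂ) :
    Matrix (ZMod (2 * l + 1)) (ZMod (2 * l + 1)) ℂ :=
  (Matrix.of fun j k => dz (fun q => matV l u q j k) p) * (matV l u p)⁻¹

/-- The matrix `Q = V Jᵀ V⁻¹`. -/
def matQ (l : ℕ) (u : ℕ → ℂ → ℝ) (p : ℂ) :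
    Matrix (ZMod (2 * l + 1)) (ZMod (2 * l + 1)) ℂ :=
  matV l u p * (matJ l).transpose * (matV l u p)⁻¹

/-- `h = (h_1, …, h_{2l+1})ᵀ` is a column solution on `U` of the Lax pair
`h_z = (λ J + P) h`, `h_z̄ = λ⁻¹ Q h` with spectral parameter `λ`. -/
def IsLaxSolution (l : ℕ) (u : ℕ → ℂ → ℝ) (lam : ℂ)
    (h : ZMod (2 * l + 1) → ℂ → ℂ) (U : Set ℂ) : Prop :=
  (∀ j, DifferentiableOn ℝ (h j) U) ∧
    ∀ p ∈ U,
      (fun j => dz (h j) p) = (lam • matJ l + matP l u p).mulVec (fun j => h j p) ∧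
      (fun j => dzbar (h j) p) = (lam⁻¹ • matQ l u p).mulVec (fun j => h j p)

/-- The functions `γ_j`. For a residue `k` modulo `2l + 1`, `k.val` is its representative
in `{0, …, 2l}`. -/
def gam (l : ℕ) (μ : ℂ) (u : ℕ → ℂ → ℝ) (h : ZMod (2 * l + 1) → ℂ → ℂ)
    (j : ZMod (2 * l + 1)) (p : ℂ) : ℝ :=
  1 / (1 + ‖μ‖ ^ (4 * l + 2)) *
    ((-‖μ‖ ^ 2) ^ (j - 1).val * ‖h 1 p‖ ^ 2
      + ∑ c ∈ Finset.Icc 1 l,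
          (-‖μ‖ ^ 2) ^ (j + (c : ZMod (2 * l + 1)) - 1).val
            * ‖h (1 + (c : ZMod (2 * l + 1))) p‖ ^ 2 * Real.exp (-u c p)
      + ∑ c ∈ Finset.Icc 1 l,
          (-‖μ‖ ^ 2) ^ (j - (c : ZMod (2 * l + 1)) - 1).val
            * ‖h (1 - (c : ZMod (2 * l + 1))) p‖ ^ 2 * Real.exp (u c p))

/-- The functions
`g_j = (1/4) |∑_c (-1)^{{c-j}} h_{2-c} h_c|² - |μ|² γ_{j-1} γ_{2-j}`, where `c` runs over all
residues modulo `2l + 1`. -/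
def gfun (l : ℕ) (μ : ℂ) (u : ℕ → ℂ → ℝ) (h : ZMod (2 * l + 1) → ℂ → ℂ)
    (j : ZMod (2 * l + 1)) (p : ℂ) : ℝ :=
  1 / 4 * ‖∑ c : ZMod (2 * l + 1), (-1 : ℂ) ^ (c - j).val * h (2 - c) p * h c p‖ ^ 2
    - ‖μ‖ ^ 2 * gam l μ u h (j - 1) p * gam l μ u h (2 - j) p

end

end EllipticToda

/-!
Write `w_k` for the exponent of the diagonal entry `V_{kk}`, with `k` modulo `2l + 1`. Then the Toda
equation says that `Δ w_k = exp (w_k - w_{k-1}) - exp (w_{k+1} - w_k)` for all `k`, under the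
reduction `w_{2-k} = -w_k`.

Set `s_j = (1/2) ∑_c (-1)^{{c-j}} h_{2-c} h_c` and `η_k = exp (-w_k) h̄_k`, so that
`g_j = |s_j|² - |μ|² γ_{j-1} γ_{2-j}`. The sums defining `s` and `γ` solve the cyclic recurrences
`s_{j+1} + s_j = h_{2-j} h_j` and `γ_{j+1} + |μ|² γ_j = h_{1-j} η_{1-j}` (`sfun_add_one`,
`gam_add_one`). Their coefficients `-1` and `-|μ|²` have no odd power equal to `1`, so a periodic
solution is unique (`eq_of_cyclic_recurrence`). Differentiating the right sides with the Lax pair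
therefore gives the derivatives in closed form
(`hasWirtingerDerivAt_gam`, `hasWirtingerDerivAt_sfun`):
`∂_z γ_j = μ̄⁻¹ h_{2-j} η_{1-j}`, `∂_z s_j = μ h_j h_{3-j}`, `∂_z̄ s_j = μ⁻¹ η̄_{j-1} η̄_{2-j}`.
For the same reason `s_{3-j} = s_j`, and hence `g_{3-j} = g_j`.

By the recurrences, `g_{k±1}` is a rational function of the quantities that occur in `g_k` and in its
derivatives. The bilinear equation
`g_k Δ g_k - ∂_z g_k ∂_z̄ g_k = exp (w_k - w_{k-1}) (g_k² - g_{k+1} g_{k-1})`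
thereby becomes an identity of rational functions (`bilinear_identity`). Divided by `g_k²`, it is
the formula for `Δ log |g_k|`; its difference for `k + 1` and `k` (`laplacian_log_gfun_div`),
added to the equation for `w_k`, is the Toda equation for `w_k + log (g_{k+1} / g_k)`. The symmetry
`g_{3-j} = g_j` is what preserves the reduction, and so the equations at both ends.
-/

namespace EllipticToda

open Complex ComplexConjugate Topology

/-! ### Calculus with `∂_z` and `∂_z̄` -/

/-- The real-linear map `v ↦ (a v + b v̄) / 2`. It is the differential of a function whose
derivatives with respect to `z = (x + i y) / 2` and `z̄ = (x - i y) / 2` are `a` and `b`. -/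
noncomputable def wirtingerCLM (a b : ℂ) : ℂ →L[ℝ] ℂ :=
  (a / 2) • ContinuousLinearMap.id ℝ ℂ + (b / 2) • (conjCLE : ℂ →L[ℝ] ℂ)

@[simp] lemma wirtingerCLM_apply (a b v : ℂ) :
    wirtingerCLM a b v = a / 2 * v + b / 2 * conj v := by
  simp [wirtingerCLM]

/-- `f` is real-differentiable at `p`, with `∂_z f = a` and `∂_z̄ f = b` there. -/
def HasWirtingerDerivAt (f : ℂ → ℂ) (a b p : ℂ) : Prop :=
  HasFDerivAt f (wirtingerCLM a b) p

lemma wirtingerCLM_of_apply (L : ℂ →L[ℝ] ℂ) :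
    wirtingerCLM (L 1 - I * L I) (L 1 + I * L I) = L := by
  ext v
  have hv : L v = (v.re : ℂ) * L 1 + (v.im : ℂ) * L I := by
    conv_lhs => rw [show v = v.re • (1 : ℂ) + v.im • I by simp]
    rw [map_add, map_smul, map_smul]; simp
  rw [hv, wirtingerCLM_apply]
  conv_lhs => rw [← re_add_im v]
  simp only [map_add, map_mul, conj_ofReal, conj_I]
  linear_combination (-(v.im : ℂ) * L I) * I_sq

lemma _root_.DifferentiableAt.hasWirtingerDerivAt {f : ℂ → ℂ} {p : ℂ}
    (hf : DifferentiableAt ℝ f p) : HasWirtingerDerivAt f (dz f p) (dzbar f p) p := by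
  unfold HasWirtingerDerivAt dz dzbar
  rw [wirtingerCLM_of_apply]
  exact hf.hasFDerivAt

namespace HasWirtingerDerivAt

variable {f g : ℂ → ℂ} {a b a' b' p : ℂ}

lemma dz_eq (hf : HasWirtingerDerivAt f a b p) : dz f p = a := by
  unfold dz
  rw [HasFDerivAt.fderiv hf, wirtingerCLM_apply, wirtingerCLM_apply]
  simp only [map_one, conj_I]
  linear_combination (-(a / 2) + b / 2) * I_sq

lemma dzbar_eq (hf : HasWirtingerDerivAt f a b p) : dzbar f p = b := by
  unfold dzbar
  rw [HasFDerivAt.fderiv hf, wirtingerCLM_apply, wirtingerCLM_apply]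
  simp only [map_one, conj_I]
  linear_combination (a / 2 - b / 2) * I_sq

lemma unique (hf : HasWirtingerDerivAt f a b p) (hf' : HasWirtingerDerivAt f a' b' p) :
    a = a' ∧ b = b' :=
  ⟨hf.dz_eq.symm.trans hf'.dz_eq, hf.dzbar_eq.symm.trans hf'.dzbar_eq⟩

lemma congr_deriv (hf : HasWirtingerDerivAt f a b p) (ha : a = a') (hb : b = b') :
    HasWirtingerDerivAt f a' b' p := ha ▸ hb ▸ hf

lemma congr_of_eventuallyEq (hf : HasWirtingerDerivAt f a b p) (hg : g =ᶠ[𝓝 p] f) :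
    HasWirtingerDerivAt g a b p :=
  HasFDerivAt.congr_of_eventuallyEq hf hg

lemma add (hf : HasWirtingerDerivAt f a b p) (hg : HasWirtingerDerivAt g a' b' p) :
    HasWirtingerDerivAt (fun q => f q + g q) (a + a') (b + b') p := by
  refine (HasFDerivAt.add hf hg).congr_fderiv ?_
  ext v; simp; ring

lemma neg (hf : HasWirtingerDerivAt f a b p) :
    HasWirtingerDerivAt (fun q => -f q) (-a) (-b) p := by
  refine (HasFDerivAt.neg hf).congr_fderiv ?_
  ext v; simp; ring

lemma sub (hf : HasWirtingerDerivAt f a b p) (hg : HasWirtingerDerivAt g a' b' p) :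
    HasWirtingerDerivAt (fun q => f q - g q) (a - a') (b - b') p := by
  simpa [sub_eq_add_neg] using hf.add hg.neg

lemma mul (hf : HasWirtingerDerivAt f a b p) (hg : HasWirtingerDerivAt g a' b' p) :
    HasWirtingerDerivAt (fun q => f q * g q) (a * g p + f p * a') (b * g p + f p * b') p := by
  refine (HasFDerivAt.mul hf hg).congr_fderiv ?_
  ext v; simp; ring

lemma const_mul (c : ℂ) (hf : HasWirtingerDerivAt f a b p) :
    HasWirtingerDerivAt (fun q => c * f q) (c * a) (c * b) p := by
  refine (HasFDerivAt.const_mul hf c).congr_fderiv ?_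
  ext v; simp; ring

lemma div (hf : HasWirtingerDerivAt f a b p) (hg : HasWirtingerDerivAt g a' b' p)
    (h0 : g p ≠ 0) :
    HasWirtingerDerivAt (fun q => f q / g q) ((a * g p - f p * a') / g p ^ 2)
      ((b * g p - f p * b') / g p ^ 2) p := by
  have hinv : HasWirtingerDerivAt (fun q => (g q)⁻¹) (-a' / g p ^ 2) (-b' / g p ^ 2) p := by
    refine (((hasDerivAt_inv h0).hasFDerivAt.restrictScalars ℝ).comp p hg).congr_fderiv ?_
    ext v; simp; ring
  simp only [div_eq_mul_inv]
  refine (hf.mul hinv).congr_deriv ?_ ?_ <;> field_simp <;> ring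

lemma conjugate (hf : HasWirtingerDerivAt f a b p) :
    HasWirtingerDerivAt (fun q => conj (f q)) (conj b) (conj a) p := by
  refine ((conjCLE : ℂ →L[ℝ] ℂ).hasFDerivAt.comp p hf).congr_fderiv ?_
  ext v; simp [Complex.conj_ofNat]; ring

lemma complex_exp (hf : HasWirtingerDerivAt f a b p) :
    HasWirtingerDerivAt (fun q => exp (f q)) (exp (f p) * a) (exp (f p) * b) p := by
  refine (HasFDerivAt.cexp hf).congr_fderiv ?_
  ext v; simp; ring

lemma complex_log (hf : HasWirtingerDerivAt f a b p) (h0 : f p ∈ slitPlane) :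
    HasWirtingerDerivAt (fun q => log (f q)) (a / f p) (b / f p) p := by
  refine (((hasStrictDerivAt_log h0).hasDerivAt.hasFDerivAt.restrictScalars ℝ).comp p
    hf).congr_fderiv ?_
  ext v; simp; ring

end HasWirtingerDerivAt

/-- `Δ f = ∂_z̄ ∂_z f`; the mixed terms cancel by the symmetry of the second derivative. -/
lemma laplacian_eq_of_hasWirtingerDerivAt {f a b : ℂ → ℂ} {p a' b' : ℂ}
    (hf : ContDiffAt ℝ 2 f p) (h1 : ∀ᶠ q in 𝓝 p, HasWirtingerDerivAt f (a q) (b q) q)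
    (h2 : HasWirtingerDerivAt a a' b' p) : Laplacian.laplacian f p = b' := by
  have hD : HasFDerivAt (fderiv ℝ f) (fderiv ℝ (fderiv ℝ f) p) p :=
    ((hf.fderiv_right (m := 1) (by norm_num)).differentiableAt (by norm_num)).hasFDerivAt
  have hsymm : fderiv ℝ (fderiv ℝ f) p 1 I = fderiv ℝ (fderiv ℝ f) p I 1 :=
    hf.isSymmSndFDerivAt (by simp) 1 I
  have hadz : a =ᶠ[𝓝 p] fun q => fderiv ℝ f q 1 - I * fderiv ℝ f q I :=
    h1.mono fun q hq => hq.dz_eq.symm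
  have e1 := ((hD.clm_apply (hasFDerivAt_const (1 : ℂ) p)).sub
    ((hD.clm_apply (hasFDerivAt_const I p)).const_mul I)).congr_of_eventuallyEq hadz
  rw [← h2.dzbar_eq, dzbar, e1.fderiv, InnerProductSpace.laplacian_eq_iteratedFDeriv_complexPlane]
  simp only [iteratedFDeriv_two_apply]
  simp
  linear_combination I * hsymm + fderiv ℝ (fderiv ℝ f) p I I * I_sq

/-- Regularity is gained from `∂_z f` and `∂_z̄ f`. -/
lemma contDiffOn_succ_of_dz_dzbar {f : ℂ → ℂ} {U : Set ℂ} (hU : IsOpen U) {n : ℕ}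
    (hf : DifferentiableOn ℝ f U) (h1 : ContDiffOn ℝ n (dz f) U)
    (h2 : ContDiffOn ℝ n (dzbar f) U) : ContDiffOn ℝ (n + 1) f U := by
  rw [contDiffOn_succ_iff_fderiv_of_isOpen hU]
  refine ⟨hf, by simp, ?_⟩
  have : ContDiffOn ℝ n (fun q => wirtingerCLM (dz f q) (dzbar f q)) U := by
    unfold wirtingerCLM
    exact ((h1.div_const 2).smul contDiffOn_const).add ((h2.div_const 2).smul contDiffOn_const)
  exact this.congr fun q hq =>
    HasFDerivAt.fderiv ((hf.differentiableAt (hU.mem_nhds hq)).hasWirtingerDerivAt)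

/-! ### Cyclic recurrences -/

/-- A first-order recurrence with constant coefficient `r` around a cycle of length `N` has at most
one solution unless `r ^ N = 1`. -/
lemma eq_of_cyclic_recurrence {N : ℕ} {r : ℂ} (hr : r ^ N ≠ 1) {x y : ZMod N → ℂ}
    (hxy : ∀ j, x (j + 1) - r * x j = y (j + 1) - r * y j) (j : ZMod N) : x j = y j := by
  have hpow : ∀ n : ℕ, x (j + n) - y (j + n) = r ^ n * (x j - y j) := by
    intro n
    induction n with
    | zero => simp
    | succ n ih =>
      have := hxy (j + n)
      rw [Nat.cast_succ, ← add_assoc, pow_succ]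
      linear_combination this + r * ih
  have hN := hpow N
  rw [ZMod.natCast_self, add_zero] at hN
  have h0 : (r ^ N - 1) * (x j - y j) = 0 := by linear_combination -hN
  exact sub_eq_zero.1 ((mul_eq_zero.1 h0).resolve_left (sub_ne_zero.2 hr))

/-- The remainder `k.val` grows with `k` by one, except for the jump from `n` to `0`. -/
lemma pow_val_add_one {R : Type*} [CommRing R] (r : R) {n : ℕ} (k : ZMod (n + 1)) :
    r ^ (k + 1).val - r * r ^ k.val = if k = -1 then 1 - r ^ (n + 1) else 0 := by
  split_ifs with hk
  · subst hk
    rw [neg_add_cancel, ZMod.val_zero, ZMod.val_neg_one, pow_zero, ← pow_succ']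
  · have hlt : k.val < n := by
      refine lt_of_le_of_ne (Nat.lt_succ_iff.1 k.val_lt) fun h => hk ?_
      apply ZMod.val_injective
      rw [h, ZMod.val_neg_one]
    have hval : (k + 1).val = k.val + 1 := by
      rw [ZMod.val_add, ZMod.val_one_eq_one_mod, Nat.add_mod_mod, Nat.mod_eq_of_lt (by omega)]
    rw [hval, pow_succ', sub_self]

/-! ### The exponents of `V` -/

section Indices

variable {l : ℕ}

lemma natCast_val_of_le {c : ℕ} (hc : c ≤ l) : ((c : ZMod (2 * l + 1))).val = c :=
  ZMod.val_cast_of_lt (by omega)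

lemma neg_natCast_val {c : ℕ} (hc : c ∈ Finset.Icc 1 l) :
    (-(c : ZMod (2 * l + 1))).val = 2 * l + 1 - c := by
  obtain ⟨h1, h2⟩ := Finset.mem_Icc.1 hc
  have h0 : (c : ZMod (2 * l + 1)) ≠ 0 := fun h => by
    have := natCast_val_of_le h2
    rw [h, ZMod.val_zero] at this
    omega
  rw [ZMod.neg_val, if_neg h0, natCast_val_of_le h2]

/-- The residues modulo `2l + 1` are `1` and `1 ± c` for `1 ≤ c ≤ l`. -/
lemma residue_cases (k : ZMod (2 * l + 1)) :
    k = 1 ∨ ∃ c ∈ Finset.Icc 1 l, k = 1 + (c : ZMod (2 * l + 1)) ∨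
      k = 1 - (c : ZMod (2 * l + 1)) := by
  have hv : ((k - 1).val : ZMod (2 * l + 1)) = k - 1 := ZMod.natCast_zmod_val _
  have hlt := (k - 1).val_lt
  rcases Nat.eq_zero_or_pos (k - 1).val with h0 | h0
  · left
    rw [h0, Nat.cast_zero] at hv
    linear_combination -hv
  · right
    rcases le_or_gt (k - 1).val l with h1 | h1
    · exact ⟨(k - 1).val, Finset.mem_Icc.2 ⟨h0, h1⟩, Or.inl (by rw [hv]; ring)⟩
    · refine ⟨2 * l + 1 - (k - 1).val, Finset.mem_Icc.2 ⟨by omega, by omega⟩, Or.inr ?_⟩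
      rw [Nat.cast_sub hlt.le, hv, ZMod.natCast_self]
      ring

lemma sum_range_two_mul_add_one {R : Type*} [AddCommMonoid R] (F : ℕ → R) :
    ∑ n ∈ Finset.range (2 * l + 1), F n =
      F 0 + ∑ c ∈ Finset.Icc 1 l, F c + ∑ c ∈ Finset.Icc 1 l, F (2 * l + 1 - c) := by
  have hIcc : ∀ G : ℕ → R, ∑ c ∈ Finset.Icc 1 l, G c = ∑ i ∈ Finset.range l, G (i + 1) := by
    intro G
    rw [Finset.range_eq_Ico, Finset.sum_Ico_add' G 0 l 1, zero_add]
    rfl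
  rw [Finset.sum_range_succ', hIcc, hIcc, two_mul, Finset.sum_range_add, add_comm, ← add_assoc,
    ← Finset.sum_range_reflect (fun i => F (l + i + 1)) l]
  congr 1
  refine Finset.sum_congr rfl fun i hi => ?_
  have := Finset.mem_range.1 hi
  congr 1
  omega

lemma sum_residues {R : Type*} [AddCommMonoid R] (f : ZMod (2 * l + 1) → R) :
    ∑ k, f k = f 1 + ∑ c ∈ Finset.Icc 1 l, f (1 + (c : ZMod (2 * l + 1)))
      + ∑ c ∈ Finset.Icc 1 l, f (1 - (c : ZMod (2 * l + 1))) := by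
  have h1 : ∑ k, f k = ∑ n ∈ Finset.range (2 * l + 1), f (1 + (n : ZMod (2 * l + 1))) := by
    rw [← Equiv.sum_comp (Equiv.addLeft (1 : ZMod (2 * l + 1))) f,
      ← Fin.sum_univ_eq_sum_range (fun n => f (1 + (n : ZMod (2 * l + 1))))]
    refine Finset.sum_congr rfl fun i _ => ?_
    rw [Equiv.coe_addLeft]
    exact congrArg (fun j => f (1 + j)) (ZMod.natCast_zmod_val (n := 2 * l + 1) i).symm
  rw [h1, sum_range_two_mul_add_one (fun n => f (1 + (n : ZMod (2 * l + 1)))), Nat.cast_zero,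
    add_zero]
  congr 1
  refine Finset.sum_congr rfl fun c hc => ?_
  rw [Nat.cast_sub (by have := Finset.mem_Icc.1 hc; omega), ZMod.natCast_self, zero_sub,
    sub_eq_add_neg]

variable (u : ℕ → ℂ → ℝ) (p : ℂ)

@[simp] lemma expo_one : expo l u 1 p = 0 := by simp [expo]

lemma expo_one_add {c : ℕ} (hc : c ∈ Finset.Icc 1 l) :
    expo l u (1 + (c : ZMod (2 * l + 1))) p = u c p := by
  obtain ⟨h1, h2⟩ := Finset.mem_Icc.1 hc
  rw [expo, add_sub_cancel_left, natCast_val_of_le h2, if_neg (by omega), if_pos h2]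

lemma expo_one_sub {c : ℕ} (hc : c ∈ Finset.Icc 1 l) :
    expo l u (1 - (c : ZMod (2 * l + 1))) p = -u c p := by
  obtain ⟨h1, h2⟩ := Finset.mem_Icc.1 hc
  rw [expo, sub_sub_cancel_left, neg_natCast_val hc, if_neg (by omega), if_neg (by omega),
    Nat.sub_sub_self (by omega)]

lemma expo_two_sub (k : ZMod (2 * l + 1)) : expo l u (2 - k) p = -expo l u k p := by
  rcases residue_cases k with rfl | ⟨c, hc, rfl | rfl⟩
  · rw [show (2 : ZMod (2 * l + 1)) - 1 = 1 by ring]; simp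
  · rw [show (2 : ZMod (2 * l + 1)) - (1 + c) = 1 - c by ring, expo_one_sub u p hc,
      expo_one_add u p hc]
  · rw [show (2 : ZMod (2 * l + 1)) - (1 - c) = 1 + c by ring, expo_one_sub u p hc,
      expo_one_add u p hc, neg_neg]

variable {u} in
lemma contDiffOn_expo {U : Set ℂ} (hu : ∀ j ∈ Finset.Icc 1 l, ContDiffOn ℝ 2 (u j) U)
    (k : ZMod (2 * l + 1)) : ContDiffOn ℝ 2 (expo l u k) U := by
  rcases residue_cases k with rfl | ⟨c, hc, rfl | rfl⟩
  · exact contDiffOn_const.congr fun q _ => expo_one u q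
  · exact (hu c hc).congr fun q _ => expo_one_add u q hc
  · exact (hu c hc).neg.congr fun q _ => expo_one_sub u q hc

end Indices

/-! ### The Lax pair in components -/

section Lax

variable {l : ℕ} {u : ℕ → ℂ → ℝ} {U : Set ℂ} {μ : ℂ} {h : ZMod (2 * l + 1) → ℂ → ℂ}

lemma inv_matV (p : ℂ) :
    (matV l u p)⁻¹ = Matrix.diagonal fun k => (Real.exp (-expo l u k p) : ℂ) := by
  refine Matrix.inv_eq_right_inv ?_
  rw [matV, Matrix.diagonal_mul_diagonal, ← Matrix.diagonal_one]
  congr 1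
  ext k
  rw [← ofReal_mul, ← Real.exp_add, add_neg_cancel, Real.exp_zero, ofReal_one]

lemma hasWirtingerDerivAt_expo (hU : IsOpen U)
    (hu : ∀ j ∈ Finset.Icc 1 l, ContDiffOn ℝ 2 (u j) U) {p : ℂ} (hp : p ∈ U)
    (k : ZMod (2 * l + 1)) :
    HasWirtingerDerivAt (fun q => (expo l u k q : ℂ)) (dz (fun q => (expo l u k q : ℂ)) p)
      (dzbar (fun q => (expo l u k q : ℂ)) p) p := by
  apply DifferentiableAt.hasWirtingerDerivAt
  exact ofRealCLM.differentiableAt.comp p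
    (((contDiffOn_expo hu k).contDiffAt (hU.mem_nhds hp)).differentiableAt (by norm_num))

lemma matP_eq (hU : IsOpen U) (hu : ∀ j ∈ Finset.Icc 1 l, ContDiffOn ℝ 2 (u j) U) {p : ℂ}
    (hp : p ∈ U) :
    matP l u p = Matrix.diagonal fun k => dz (fun q => (expo l u k q : ℂ)) p := by
  have hV : (Matrix.of fun j k => dz (fun q => matV l u q j k) p) =
      Matrix.diagonal fun k : ZMod (2 * l + 1) =>
        (Real.exp (expo l u k p) : ℂ) * dz (fun q => (expo l u k q : ℂ)) p := by
    ext j k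
    rw [Matrix.of_apply, Matrix.diagonal_apply]
    split_ifs with hjk
    · subst hjk
      simp only [matV, Matrix.diagonal_apply_eq, ofReal_exp]
      exact (hasWirtingerDerivAt_expo hU hu hp j).complex_exp.dz_eq
    · simp [matV, Matrix.diagonal_apply_ne _ hjk, dz]
  rw [matP, hV, inv_matV, Matrix.diagonal_mul_diagonal]
  congr 1
  ext k
  rw [mul_right_comm, ← ofReal_mul, ← Real.exp_add, add_neg_cancel, Real.exp_zero, ofReal_one,
    one_mul]

lemma matJ_mulVec (v : ZMod (2 * l + 1) → ℂ) (k : ZMod (2 * l + 1)) :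
    (matJ l).mulVec v k = v (k + 1) := by
  simp [matJ, Matrix.mulVec, dotProduct]

lemma matQ_mulVec (p : ℂ) (v : ZMod (2 * l + 1) → ℂ) (k : ZMod (2 * l + 1)) :
    (matQ l u p).mulVec v k =
      (Real.exp (expo l u k p) : ℂ) * Real.exp (-expo l u (k - 1) p) * v (k - 1) := by
  rw [matQ, inv_matV, matV, Matrix.mulVec, dotProduct, Finset.sum_eq_single (k - 1)]
  · simp [matJ]
  · intro j _ hj
    have : j + 1 ≠ k := fun h => hj (by rw [← h]; ring)
    simp [matJ, this]
  · simp

/-- The Lax pair in components: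
`∂_z h_k = μ h_{k+1} + ∂_z w_k h_k` and `∂_z̄ h_k = μ⁻¹ exp (w_k - w_{k-1}) h_{k-1}`, where `w_k`
is the exponent of `V_{kk}`. -/
lemma IsLaxSolution.hasWirtingerDerivAt (hh : IsLaxSolution l u μ h U) (hU : IsOpen U)
    (hu : ∀ j ∈ Finset.Icc 1 l, ContDiffOn ℝ 2 (u j) U) {p : ℂ} (hp : p ∈ U)
    (k : ZMod (2 * l + 1)) :
    HasWirtingerDerivAt (h k) (μ * h (k + 1) p + dz (fun q => (expo l u k q : ℂ)) p * h k p)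
      (μ⁻¹ * (exp (expo l u k p) * exp (-expo l u (k - 1) p)) * h (k - 1) p) p := by
  have h1 := congrFun (hh.2 p hp).1 k
  have h2 := congrFun (hh.2 p hp).2 k
  rw [matP_eq hU hu hp, Matrix.add_mulVec, Matrix.smul_mulVec, Pi.add_apply, Pi.smul_apply,
    matJ_mulVec, Matrix.mulVec_diagonal, smul_eq_mul] at h1
  rw [Matrix.smul_mulVec, Pi.smul_apply, matQ_mulVec, smul_eq_mul] at h2
  have hd := (((hh.1 k).differentiableAt (hU.mem_nhds hp))).hasWirtingerDerivAt
  refine hd.congr_deriv h1 (h2.trans ?_)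
  push_cast
  ring

/-- A solution of the Lax pair of a `C²` potential is `C²`: its first derivatives are expressed
through itself and the first derivatives of the potential. -/
lemma IsLaxSolution.contDiffOn (hh : IsLaxSolution l u μ h U) (hU : IsOpen U)
    (hu : ∀ j ∈ Finset.Icc 1 l, ContDiffOn ℝ 2 (u j) U) (k : ZMod (2 * l + 1)) :
    ContDiffOn ℝ 2 (h k) U := by
  have hw : ∀ k, ContDiffOn ℝ 2 (fun q => (expo l u k q : ℂ)) U := fun k =>
    ofRealCLM.contDiff.comp_contDiffOn (contDiffOn_expo hu k)
  have hdw : ∀ k, ContDiffOn ℝ 1 (dz fun q => (expo l u k q : ℂ)) U := fun k => by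
    have := (hw k).fderiv_of_isOpen (m := 1) hU (by norm_num)
    exact (this.clm_apply contDiffOn_const).sub
      (contDiffOn_const.mul (this.clm_apply contDiffOn_const))
  have step : ∀ n : ℕ, n ≤ 1 → (∀ k, ContDiffOn ℝ n (h k) U) →
      ∀ k, ContDiffOn ℝ (n + 1) (h k) U := by
    intro n hn hk k
    have hn1 : (n : WithTop ℕ∞) ≤ 1 := by exact_mod_cast hn
    have hn2 : (n : WithTop ℕ∞) ≤ 2 := hn1.trans (by norm_num)
    refine contDiffOn_succ_of_dz_dzbar hU (hh.1 k) ?_ ?_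
    · refine ContDiffOn.congr ?_ fun q hq => (hh.hasWirtingerDerivAt hU hu hq k).dz_eq
      exact (contDiffOn_const.mul (hk _)).add (((hdw k).of_le hn1).mul (hk _))
    · refine ContDiffOn.congr ?_ fun q hq => (hh.hasWirtingerDerivAt hU hu hq k).dzbar_eq
      exact (contDiffOn_const.mul (((hw k).of_le hn2).cexp.mul
        ((hw (k - 1)).of_le hn2).neg.cexp)).mul (hk _)
  have h0 : ∀ k, ContDiffOn ℝ (0 : ℕ) (h k) U := fun k =>
    contDiffOn_zero.2 (hh.1 k).continuousOn
  have h2 := step 1 le_rfl (fun k => by simpa using step 0 zero_le_one h0 k) k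
  exact h2.of_le (by norm_num)

end Lax

/-! ### Recurrences and symmetries of `s`, `γ` and `g` -/

section Algebra

variable {l : ℕ} (μ : ℂ) (u : ℕ → ℂ → ℝ) (h : ZMod (2 * l + 1) → ℂ → ℂ)

/-- The functions `s_j = (1/2) ∑_c (-1)^{{c-j}} h_{2-c} h_c`, so that
`g_j = |s_j|² - |μ|² γ_{j-1} γ_{2-j}`. -/
noncomputable def sfun (j : ZMod (2 * l + 1)) (p : ℂ) : ℂ :=
  1 / 2 * ∑ c : ZMod (2 * l + 1), (-1) ^ (c - j).val * h (2 - c) p * h c p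

/-- The functions `η_k = exp (-w_k) h̄_k`, where `w_k` is the exponent of `V_{kk}`. -/
noncomputable def eta (k : ZMod (2 * l + 1)) (p : ℂ) : ℂ :=
  conj (h k p) * exp (-expo l u k p)

/-- The derivative `∂_z g_k` in terms of `h`, `η`, `γ` and `s`. -/
noncomputable def gz (k : ZMod (2 * l + 1)) (p : ℂ) : ℂ :=
  μ * (h k p * h (3 - k) p * conj (sfun h k p))
    + (conj μ)⁻¹ * (eta u h (k - 1) p * eta u h (2 - k) p * sfun h k p)
    - μ * (h (3 - k) p * eta u h (2 - k) p * gam l μ u h (2 - k) p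
      + h k p * eta u h (k - 1) p * gam l μ u h (k - 1) p)

lemma conj_eta (k : ZMod (2 * l + 1)) (p : ℂ) :
    conj (eta u h k p) = h k p * exp (-expo l u k p) := by
  simp [eta, ← exp_conj]

lemma neg_one_pow_ne_one : (-1 : ℂ) ^ (2 * l + 1) ≠ 1 := by
  rw [Odd.neg_one_pow ⟨l, rfl⟩]
  norm_num

lemma neg_normSq_pow_ne_one : (-(μ * conj μ)) ^ (2 * l + 1) ≠ 1 := by
  rw [mul_conj, ← ofReal_neg, ← ofReal_pow, ← ofReal_one, Ne, ofReal_inj, Odd.neg_pow ⟨l, rfl⟩]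
  have := pow_nonneg (normSq_nonneg μ) (2 * l + 1)
  linarith

/-- The recurrence that characterizes the functions `s_j`. -/
lemma sfun_add_one (j : ZMod (2 * l + 1)) (p : ℂ) :
    sfun h (j + 1) p + sfun h j p = h (2 - j) p * h j p := by
  have key : ∀ c : ZMod (2 * l + 1), (-1 : ℂ) ^ (c - (j + 1)).val * h (2 - c) p * h c p
      + (-1 : ℂ) ^ (c - j).val * h (2 - c) p * h c p =
        if c = j then 2 * (h (2 - c) p * h c p) else 0 := by
    intro c
    have hpow := pow_val_add_one (-1 : ℂ) (c - (j + 1))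
    rw [show c - (j + 1) + 1 = c - j by ring, Odd.neg_one_pow ⟨l, rfl⟩] at hpow
    have hiff : c - (j + 1) = -1 ↔ c = j :=
      ⟨fun e => by linear_combination e, fun e => by rw [e]; ring⟩
    simp only [hiff] at hpow
    split_ifs at hpow ⊢ <;> linear_combination h (2 - c) p * h c p * hpow
  rw [sfun, sfun, ← mul_add, ← Finset.sum_add_distrib, Finset.sum_congr rfl fun c _ => key c,
    Finset.sum_ite_eq' Finset.univ j]
  simp

lemma sfun_three_sub (j : ZMod (2 * l + 1)) (p : ℂ) : sfun h (3 - j) p = sfun h j p := by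
  refine eq_of_cyclic_recurrence (x := fun j => sfun h (3 - j) p) (y := fun j => sfun h j p)
    (neg_one_pow_ne_one (l := l)) (fun j => ?_) j
  have h1 := sfun_add_one h (2 - j) p
  have h2 := sfun_add_one h j p
  rw [show 2 - j + 1 = 3 - j by ring, show 2 - (2 - j) = j by ring] at h1
  simp only [show 3 - (j + 1) = 2 - j by ring]
  linear_combination h1 - h2

lemma gam_eq_sum (j : ZMod (2 * l + 1)) (p : ℂ) :
    gam l μ u h j p = 1 / (1 + ‖μ‖ ^ (4 * l + 2)) *
      ∑ m, (-‖μ‖ ^ 2) ^ (j + m - 2).val * (‖h m p‖ ^ 2 * Real.exp (-expo l u m p)) := by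
  rw [gam, sum_residues]
  congr 1
  congr 1
  · congr 1
    · rw [expo_one, neg_zero, Real.exp_zero, mul_one, show j + 1 - 2 = j - 1 by ring]
    · refine Finset.sum_congr rfl fun c hc => ?_
      rw [expo_one_add u p hc, mul_assoc, show j + (1 + (c : ZMod (2 * l + 1))) - 2 = j + c - 1 by
        ring]
  · refine Finset.sum_congr rfl fun c hc => ?_
    rw [expo_one_sub u p hc, mul_assoc, neg_neg,
      show j + (1 - (c : ZMod (2 * l + 1))) - 2 = j - c - 1 by ring]

/-- The recurrence that characterizes the functions `γ_j`. The normalizing factor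
`1 / (1 + |μ|^(4l+2))` accounts for the jump of the remainder once around the cycle. -/
lemma gam_add_one (j : ZMod (2 * l + 1)) (p : ℂ) :
    (gam l μ u h (j + 1) p : ℂ) + μ * conj μ * gam l μ u h j p =
      h (1 - j) p * eta u h (1 - j) p := by
  have key : ∀ m : ZMod (2 * l + 1),
      (-‖μ‖ ^ 2) ^ (j + 1 + m - 2).val * (‖h m p‖ ^ 2 * Real.exp (-expo l u m p))
        + ‖μ‖ ^ 2 * ((-‖μ‖ ^ 2) ^ (j + m - 2).val * (‖h m p‖ ^ 2 * Real.exp (-expo l u m p))) =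
        if m = 1 - j then
          (1 + ‖μ‖ ^ (4 * l + 2)) * (‖h m p‖ ^ 2 * Real.exp (-expo l u m p)) else 0 := by
    intro m
    have hpow := pow_val_add_one (-‖μ‖ ^ 2) (j + m - 2)
    rw [show j + m - 2 + 1 = j + 1 + m - 2 by ring, Odd.neg_pow ⟨l, rfl⟩, ← pow_mul,
      show 2 * (2 * l + 1) = 4 * l + 2 by ring] at hpow
    have hiff : j + m - 2 = -1 ↔ m = 1 - j :=
      ⟨fun e => by linear_combination e, fun e => by rw [e]; ring⟩
    simp only [hiff] at hpow
    split_ifs at hpow ⊢ <;>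
      linear_combination (‖h m p‖ ^ 2 * Real.exp (-expo l u m p)) * hpow
  have hreal : gam l μ u h (j + 1) p + ‖μ‖ ^ 2 * gam l μ u h j p =
      ‖h (1 - j) p‖ ^ 2 * Real.exp (-expo l u (1 - j) p) := by
    have h0 : (1 + ‖μ‖ ^ (4 * l + 2) : ℝ) ≠ 0 := by positivity
    rw [gam_eq_sum, gam_eq_sum, mul_left_comm, ← mul_add, Finset.mul_sum,
      ← Finset.sum_add_distrib, Finset.sum_congr rfl fun m _ => key m,
      Finset.sum_ite_eq' Finset.univ (1 - j), if_pos (Finset.mem_univ _)]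
    field_simp
  have hc := congrArg ((↑) : ℝ → ℂ) hreal
  push_cast at hc
  rw [mul_conj', hc, eta, ← mul_assoc, mul_conj']

lemma gfun_eq (j : ZMod (2 * l + 1)) (p : ℂ) :
    (gfun l μ u h j p : ℂ) = sfun h j p * conj (sfun h j p)
      - μ * conj μ * gam l μ u h (j - 1) p * gam l μ u h (2 - j) p := by
  rw [gfun, mul_conj', mul_conj', sfun, norm_mul]
  push_cast
  norm_num
  ring

lemma gfun_three_sub (j : ZMod (2 * l + 1)) (p : ℂ) :
    gfun l μ u h (3 - j) p = gfun l μ u h j p := by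
  rw [← ofReal_inj, gfun_eq, gfun_eq, sfun_three_sub, show 3 - j - 1 = 2 - j by ring,
    show 2 - (3 - j) = j - 1 by ring]
  ring

end Algebra

/-! ### Derivatives of `s`, `γ` and `g`, and the bilinear equation -/

section Derivatives

variable {l : ℕ} {u : ℕ → ℂ → ℝ} {U : Set ℂ} {μ : ℂ} {h : ZMod (2 * l + 1) → ℂ → ℂ}

lemma contDiffOn_gam (hU : IsOpen U) (hu : ∀ j ∈ Finset.Icc 1 l, ContDiffOn ℝ 2 (u j) U)
    (hh : IsLaxSolution l u μ h U) (j : ZMod (2 * l + 1)) :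
    ContDiffOn ℝ 2 (gam l μ u h j) U := by
  refine ContDiffOn.congr ?_ fun q _ => gam_eq_sum μ u h j q
  refine contDiffOn_const.mul (ContDiffOn.sum fun m _ => contDiffOn_const.mul ?_)
  exact ((hh.contDiffOn hU hu m).norm_sq ℝ).mul (contDiffOn_expo hu m).neg.exp

lemma contDiffOn_gfun (hU : IsOpen U) (hu : ∀ j ∈ Finset.Icc 1 l, ContDiffOn ℝ 2 (u j) U)
    (hh : IsLaxSolution l u μ h U) (j : ZMod (2 * l + 1)) :
    ContDiffOn ℝ 2 (gfun l μ u h j) U := by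
  have hc := hh.contDiffOn hU hu
  refine ContDiffOn.sub (contDiffOn_const.mul (ContDiffOn.norm_sq ℝ (ContDiffOn.sum fun c _ =>
    (contDiffOn_const.mul (hc _)).mul (hc _)))) ?_
  exact (contDiffOn_const.mul (contDiffOn_gam hU hu hh _)).mul (contDiffOn_gam hU hu hh _)

lemma hasWirtingerDerivAt_eta (hU : IsOpen U)
    (hu : ∀ j ∈ Finset.Icc 1 l, ContDiffOn ℝ 2 (u j) U) (hh : IsLaxSolution l u μ h U) {p : ℂ}
    (hp : p ∈ U) (k : ZMod (2 * l + 1)) :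
    HasWirtingerDerivAt (eta u h k)
      ((conj μ)⁻¹ * eta u h (k - 1) p - dz (fun q => (expo l u k q : ℂ)) p * eta u h k p)
      (conj μ * conj (h (k + 1) p) * exp (-expo l u k p)) p := by
  have hw := hasWirtingerDerivAt_expo hU hu hp k
  have hreal : conj (dz (fun q => (expo l u k q : ℂ)) p) =
      dzbar (fun q => (expo l u k q : ℂ)) p := by
    have := hw.conjugate
    simp only [conj_ofReal] at this
    exact (this.unique hw).2
  have hexp : exp (expo l u k p : ℂ) * exp (-expo l u k p) = 1 := by
    rw [← Complex.exp_add, add_neg_cancel, Complex.exp_zero]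
  refine ((hh.hasWirtingerDerivAt hU hu hp k).conjugate.mul hw.neg.complex_exp).congr_deriv ?_ ?_
  · simp only [map_mul, map_inv₀, ← exp_conj, map_neg, conj_ofReal, eta]
    linear_combination (conj μ)⁻¹ * exp (-expo l u (k - 1) p) * conj (h (k - 1) p) * hexp
  · simp only [map_mul, map_add, hreal]
    ring

/-- The derivatives of `γ`: `∂_z γ` satisfies the recurrence obtained by differentiating
`gam_add_one`, which the stated expression solves. -/
lemma hasWirtingerDerivAt_gam (hU : IsOpen U)
    (hu : ∀ j ∈ Finset.Icc 1 l, ContDiffOn ℝ 2 (u j) U) (hh : IsLaxSolution l u μ h U)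
    (hμ0 : μ ≠ 0) {p : ℂ} (hp : p ∈ U) (j : ZMod (2 * l + 1)) :
    HasWirtingerDerivAt (fun q => (gam l μ u h j q : ℂ))
      ((conj μ)⁻¹ * h (2 - j) p * eta u h (1 - j) p)
      (μ⁻¹ * conj (h (2 - j) p) * conj (eta u h (1 - j) p)) p := by
  have hμ' : conj μ ≠ 0 := (map_ne_zero _).2 hμ0
  have hd : ∀ j, HasWirtingerDerivAt (fun q => (gam l μ u h j q : ℂ))
      (dz (fun q => (gam l μ u h j q : ℂ)) p) (dzbar (fun q => (gam l μ u h j q : ℂ)) p) p :=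
    fun j => (ofRealCLM.differentiableAt.comp p (((contDiffOn_gam hU hu hh j).contDiffAt
      (hU.mem_nhds hp)).differentiableAt (by norm_num))).hasWirtingerDerivAt
  have hz : ∀ j, dz (fun q => (gam l μ u h j q : ℂ)) p =
      (conj μ)⁻¹ * h (2 - j) p * eta u h (1 - j) p := by
    refine eq_of_cyclic_recurrence (neg_normSq_pow_ne_one (l := l) μ) fun j => ?_
    have h1 := (hd (j + 1)).add ((hd j).const_mul (μ * conj μ))
    simp only [gam_add_one] at h1
    have h2 := (h1.unique ((hh.hasWirtingerDerivAt hU hu hp (1 - j)).mul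
      (hasWirtingerDerivAt_eta hU hu hh hp (1 - j)))).1
    rw [show 1 - j + 1 = 2 - j by ring] at h2
    rw [show 2 - (j + 1) = 1 - j by ring, show 1 - (j + 1) = 1 - j - 1 by ring]
    linear_combination h2 + (-μ * h (2 - j) p * eta u h (1 - j) p) * mul_inv_cancel₀ hμ'
  -- Since `γ_j` is real, its `∂_z̄`-derivative is the conjugate of the `∂_z`-derivative.
  have hreal := (hd j).conjugate
  simp only [conj_ofReal] at hreal
  refine (hd j).congr_deriv (hz j) ?_
  rw [← (hreal.unique (hd j)).2, hz j]
  simp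

/-- The derivatives of `s`, from the recurrence obtained by differentiating `sfun_add_one`. The
derivatives of the exponents cancel because `w_{2-j} = -w_j`. -/
lemma hasWirtingerDerivAt_sfun (hU : IsOpen U)
    (hu : ∀ j ∈ Finset.Icc 1 l, ContDiffOn ℝ 2 (u j) U) (hh : IsLaxSolution l u μ h U)
    {p : ℂ} (hp : p ∈ U) (j : ZMod (2 * l + 1)) :
    HasWirtingerDerivAt (sfun h j) (μ * h j p * h (3 - j) p)
      (μ⁻¹ * conj (eta u h (j - 1) p) * conj (eta u h (2 - j) p)) p := by
  have hd : ∀ j, HasWirtingerDerivAt (sfun h j) (dz (sfun h j) p) (dzbar (sfun h j) p) p := by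
    intro j
    refine DifferentiableAt.hasWirtingerDerivAt
      (ContDiffAt.differentiableAt (n := 2) ?_ two_ne_zero)
    have hc := fun k => (hh.contDiffOn hU hu k).contDiffAt (hU.mem_nhds hp)
    exact contDiffAt_const.mul (ContDiffAt.sum fun c _ => (contDiffAt_const.mul (hc _)).mul (hc _))
  have hrec : ∀ j, dz (sfun h (j + 1)) p + dz (sfun h j) p =
        μ * (h (3 - j) p * h j p + h (2 - j) p * h (j + 1) p) ∧
      dzbar (sfun h (j + 1)) p + dzbar (sfun h j) p =
        μ⁻¹ * (conj (eta u h (1 - j) p) * conj (eta u h j p) +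
          conj (eta u h (j - 1) p) * conj (eta u h (2 - j) p)) := by
    intro j
    have h1 := (hd (j + 1)).add (hd j)
    simp only [sfun_add_one] at h1
    have hw : ∀ k : ZMod (2 * l + 1), (expo l u (2 - k) p : ℂ) = -expo l u k p := fun k => by
      rw [expo_two_sub, ofReal_neg]
    have hdw : dz (fun q => (expo l u (2 - j) q : ℂ)) p =
        -dz (fun q => (expo l u j q : ℂ)) p := by
      simp only [expo_two_sub, ofReal_neg]
      exact (hasWirtingerDerivAt_expo hU hu hp j).neg.dz_eq
    have h2 := h1.unique ((hh.hasWirtingerDerivAt hU hu hp (2 - j)).mul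
      (hh.hasWirtingerDerivAt hU hu hp j))
    rw [show 2 - j + 1 = 3 - j by ring, show 2 - j - 1 = 1 - j by ring, hdw, hw] at h2
    refine ⟨by linear_combination h2.1, ?_⟩
    simp only [conj_eta, hw]
    rw [neg_neg]
    linear_combination h2.2
  refine (hd j).congr_deriv ?_ ?_
  · refine eq_of_cyclic_recurrence (x := fun j => dz (sfun h j) p)
      (y := fun j => μ * h j p * h (3 - j) p) (neg_one_pow_ne_one (l := l)) (fun j => ?_) j
    simp only [show 3 - (j + 1) = 2 - j by ring]
    linear_combination (hrec j).1
  · refine eq_of_cyclic_recurrence (x := fun j => dzbar (sfun h j) p)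
      (y := fun j => μ⁻¹ * conj (eta u h (j - 1) p) * conj (eta u h (2 - j) p))
      (neg_one_pow_ne_one (l := l)) (fun j => ?_) j
    simp only [show j + 1 - 1 = j by ring, show 2 - (j + 1) = 1 - j by ring]
    linear_combination (hrec j).2

lemma hasWirtingerDerivAt_gfun (hU : IsOpen U)
    (hu : ∀ j ∈ Finset.Icc 1 l, ContDiffOn ℝ 2 (u j) U) (hh : IsLaxSolution l u μ h U)
    (hμ0 : μ ≠ 0) {p : ℂ} (hp : p ∈ U) (k : ZMod (2 * l + 1)) :
    HasWirtingerDerivAt (fun q => (gfun l μ u h k q : ℂ)) (gz μ u h k p)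
      (conj (gz μ u h k p)) p := by
  have hμ' : conj μ ≠ 0 := (map_ne_zero _).2 hμ0
  simp only [gfun_eq]
  have hs := hasWirtingerDerivAt_sfun hU hu hh hp k
  have hA := hasWirtingerDerivAt_gam hU hu hh hμ0 hp (k - 1)
  have hB := hasWirtingerDerivAt_gam hU hu hh hμ0 hp (2 - k)
  rw [show 2 - (k - 1) = 3 - k by ring, show 1 - (k - 1) = 2 - k by ring] at hA
  rw [show 2 - (2 - k) = k by ring, show 1 - (2 - k) = k - 1 by ring] at hB
  refine ((hs.mul hs.conjugate).sub ((hA.const_mul (μ * conj μ)).mul hB)).congr_deriv ?_ ?_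
  · simp only [gz, map_mul, map_inv₀, conj_conj]
    field_simp
  · simp only [gz, map_add, map_sub, map_mul, map_inv₀, conj_conj, conj_ofReal]
    field_simp
    ring

/-- The bilinear identity behind the Darboux transformation, as a statement about numbers. Here
`a, b, c, d` stand for `h_k, h_{3-k}, h_{k-1}, h_{2-k}`, the letters `A, A₁, A₂` for
`γ_{k-1}, γ_k, γ_{k-2}`, the letters `B, B₁, B₂` for `γ_{2-k}, γ_{1-k}, γ_{3-k}`, while
`P = exp w_k` and `Q = exp (-w_{k-1})`; a prime marks the conjugate. -/
lemma bilinear_identity {μ μ' a a' b b' c c' d d' s s' A A₁ A₂ B B₁ B₂ P P' Q Q' : ℂ}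
    (hμ : μ ≠ 0) (hμ' : μ' ≠ 0) (hP : P * P' = 1) (hQ : Q * Q' = 1)
    (hA₁ : A₁ + μ * μ' * A = d * (d' * P)) (hA₂ : A + μ * μ' * A₂ = b * (b' * Q'))
    (hB₁ : B + μ * μ' * B₁ = a * (a' * P')) (hB₂ : B₂ + μ * μ' * B = c * (c' * Q)) :
    (P * Q * ((b * c + a * d) * s' + (b' * c' + a' * d') * s) + μ * μ' * a * a' * b * b'
        + μ⁻¹ * μ'⁻¹ * P ^ 2 * Q ^ 2 * c * c' * d * d'
        - (P ^ 2 * Q * d * d' + μ * μ' * P * b * b') * B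
        - (P * Q ^ 2 * c * c' + μ * μ' * Q * a * a') * A
        - P * Q * (b * c * a' * d' + b' * c' * a * d)) * (s * s' - μ * μ' * A * B)
      - (μ * (a * b * s') + μ'⁻¹ * (c' * Q * (d' * P) * s)
          - μ * (b * (d' * P) * B + a * (c' * Q) * A))
        * (μ' * (a' * b' * s) + μ⁻¹ * (c * Q * (d * P) * s')
          - μ' * (b' * (d * P) * B + a' * (c * Q) * A)) =
      P * Q * ((s * s' - μ * μ' * A * B) ^ 2
        - ((a * d - s) * (a' * d' - s') - μ * μ' * A₁ * B₁)
          * ((b * c - s) * (b' * c' - s') - μ * μ' * A₂ * B₂)) := by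
  obtain rfl : P' = P⁻¹ := eq_inv_of_mul_eq_one_right hP
  obtain rfl : Q' = Q⁻¹ := eq_inv_of_mul_eq_one_right hQ
  have hP0 : P ≠ 0 := left_ne_zero_of_mul_eq_one hP
  have hQ0 : Q ≠ 0 := left_ne_zero_of_mul_eq_one hQ
  obtain rfl : A₁ = d * (d' * P) - μ * μ' * A := by linear_combination hA₁
  obtain rfl : B₂ = c * (c' * Q) - μ * μ' * B := by linear_combination hB₂
  obtain rfl : A₂ = (b * (b' * Q⁻¹) - A) * (μ⁻¹ * μ'⁻¹) := by
    field_simp; field_simp at hA₂; linear_combination hA₂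
  obtain rfl : B₁ = (a * (a' * P⁻¹) - B) * (μ⁻¹ * μ'⁻¹) := by
    field_simp; field_simp at hB₁; linear_combination hB₁
  field_simp
  ring

/-- The bilinear equation `g Δg - ∂_z g ∂_z̄ g = exp (w_k - w_{k-1}) (g_k² - g_{k+1} g_{k-1})`
for `g = g_k`, with `Δg = ∂_z̄ ∂_z g` given as the number `β`. -/
lemma exists_hasWirtingerDerivAt_gz (hU : IsOpen U)
    (hu : ∀ j ∈ Finset.Icc 1 l, ContDiffOn ℝ 2 (u j) U) (hh : IsLaxSolution l u μ h U)
    (hμ0 : μ ≠ 0) {p : ℂ} (hp : p ∈ U) (k : ZMod (2 * l + 1)) :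
    ∃ α β : ℂ, HasWirtingerDerivAt (gz μ u h k) α β p ∧
      β * gfun l μ u h k p - gz μ u h k p * conj (gz μ u h k p) =
        exp (expo l u k p) * exp (-expo l u (k - 1) p) *
          ((gfun l μ u h k p : ℂ) ^ 2 - gfun l μ u h (k + 1) p * gfun l μ u h (k - 1) p) := by
  have hμ' : conj μ ≠ 0 := (map_ne_zero _).2 hμ0
  have hw : ∀ k : ZMod (2 * l + 1), (expo l u (2 - k) p : ℂ) = -expo l u k p := fun k => by
    rw [expo_two_sub, ofReal_neg]
  have hw' : (expo l u (3 - k) p : ℂ) = -expo l u (k - 1) p := by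
    rw [← hw, show 2 - (k - 1) = 3 - k by ring]
  have hs := hasWirtingerDerivAt_sfun hU hu hh hp k
  have hA := hasWirtingerDerivAt_gam hU hu hh hμ0 hp (k - 1)
  have hB := hasWirtingerDerivAt_gam hU hu hh hμ0 hp (2 - k)
  have ha := hh.hasWirtingerDerivAt hU hu hp k
  have hb := hh.hasWirtingerDerivAt hU hu hp (3 - k)
  have hc := hasWirtingerDerivAt_eta hU hu hh hp (k - 1)
  have hd := hasWirtingerDerivAt_eta hU hu hh hp (2 - k)
  rw [show 2 - (k - 1) = 3 - k by ring, show 1 - (k - 1) = 2 - k by ring] at hA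
  rw [show 2 - (2 - k) = k by ring, show 1 - (2 - k) = k - 1 by ring] at hB
  rw [show 3 - k - 1 = 2 - k by ring, hw', hw, neg_neg] at hb
  rw [show k - 1 + 1 = k by ring] at hc
  rw [show 2 - k + 1 = 3 - k by ring, hw, neg_neg] at hd
  refine ⟨_, _, ((((ha.mul hb).mul hs.conjugate).const_mul μ).add
    (((hc.mul hd).mul hs).const_mul (conj μ)⁻¹)).sub
    ((((hb.mul hd).mul hB).add ((ha.mul hc).mul hA)).const_mul μ), ?_⟩
  have rA₁ := gam_add_one μ u h (k - 1) p
  have rA₂ := gam_add_one μ u h (k - 2) p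
  have rB₁ := gam_add_one μ u h (1 - k) p
  have rB₂ := gam_add_one μ u h (2 - k) p
  rw [show k - 1 + 1 = k by ring, show 1 - (k - 1) = 2 - k by ring, eta, hw, neg_neg] at rA₁
  rw [show k - 2 + 1 = k - 1 by ring, show 1 - (k - 2) = 3 - k by ring, eta, hw', neg_neg] at rA₂
  rw [show 1 - k + 1 = 2 - k by ring, show 1 - (1 - k) = k by ring, eta] at rB₁
  rw [show 2 - k + 1 = 3 - k by ring, show 1 - (2 - k) = k - 1 by ring, eta] at rB₂
  have hexp : ∀ z : ℂ, exp z * exp (-z) = 1 := fun z => by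
    rw [← Complex.exp_add, add_neg_cancel, Complex.exp_zero]
  have key := bilinear_identity (s := sfun h k p) (s' := conj (sfun h k p)) hμ0 hμ'
    (hexp (expo l u k p)) ((mul_comm _ _).trans (hexp (expo l u (k - 1) p))) rA₁ rA₂ rB₁ rB₂
  have hs₁ : sfun h (k + 1) p = h k p * h (2 - k) p - sfun h k p := by
    linear_combination sfun_add_one h k p
  have hs₂ : sfun h (k - 1) p = h (3 - k) p * h (k - 1) p - sfun h k p := by
    have := sfun_add_one h (k - 1) p
    rw [show k - 1 + 1 = k by ring, show 2 - (k - 1) = 3 - k by ring] at this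
    linear_combination this
  simp only [gfun_eq, show k + 1 - 1 = k by ring, show 2 - (k + 1) = 1 - k by ring,
    show k - 1 - 1 = k - 2 by ring, show 2 - (k - 1) = 3 - k by ring, hs₁, hs₂, map_sub, map_mul]
  rw [← key]
  simp only [gz, map_add, map_sub, map_mul, map_inv₀, conj_conj, conj_ofReal, conj_eta]
  simp only [eta, hw, neg_neg]
  field_simp
  ring

/-- `Δ log (g_{k+1} / g_k)`, from the bilinear equations for `g_k` and `g_{k+1}`. -/
lemma laplacian_log_gfun_div (hU : IsOpen U)
    (hu : ∀ j ∈ Finset.Icc 1 l, ContDiffOn ℝ 2 (u j) U) (hh : IsLaxSolution l u μ h U)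
    (hμ0 : μ ≠ 0) {k : ZMod (2 * l + 1)}
    (hpos : ∀ q ∈ U, 0 < gfun l μ u h (k + 1) q / gfun l μ u h k q) {p : ℂ} (hp : p ∈ U) :
    Laplacian.laplacian
        (fun q => Real.log (gfun l μ u h (k + 1) q / gfun l μ u h k q)) p =
      Real.exp (expo l u (k + 1) p - expo l u k p) *
          (1 - gfun l μ u h (k + 2) p * gfun l μ u h k p / gfun l μ u h (k + 1) p ^ 2)
        - Real.exp (expo l u k p - expo l u (k - 1) p) *
          (1 - gfun l μ u h (k + 1) p * gfun l μ u h (k - 1) p / gfun l μ u h k p ^ 2) := by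
  have hne : ∀ q ∈ U, gfun l μ u h (k + 1) q ≠ 0 ∧ gfun l μ u h k q ≠ 0 := fun q hq =>
    div_ne_zero_iff.1 (hpos q hq).ne'
  have hC : ContDiffAt ℝ 2
      (fun q => Real.log (gfun l μ u h (k + 1) q / gfun l μ u h k q)) p :=
    (((contDiffOn_gfun hU hu hh (k + 1)).div (contDiffOn_gfun hU hu hh k) fun q hq =>
      (hne q hq).2).log fun q hq => (hpos q hq).ne').contDiffAt (hU.mem_nhds hp)
  have hd1 : ∀ q ∈ U, HasWirtingerDerivAt
      (fun q => ((Real.log (gfun l μ u h (k + 1) q / gfun l μ u h k q) : ℝ) : ℂ))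
      (gz μ u h (k + 1) q / gfun l μ u h (k + 1) q - gz μ u h k q / gfun l μ u h k q)
      (conj (gz μ u h (k + 1) q) / gfun l μ u h (k + 1) q
        - conj (gz μ u h k q) / gfun l μ u h k q) q := by
    intro q hq
    have h0 : (gfun l μ u h k q : ℂ) ≠ 0 := ofReal_ne_zero.2 (hne q hq).2
    have h1 : (gfun l μ u h (k + 1) q : ℂ) ≠ 0 := ofReal_ne_zero.2 (hne q hq).1
    have hlog := ((hasWirtingerDerivAt_gfun hU hu hh hμ0 hq (k + 1)).div
      (hasWirtingerDerivAt_gfun hU hu hh hμ0 hq k) h0).complex_log (by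
        rw [← ofReal_div]; exact ofReal_mem_slitPlane.2 (hpos q hq))
    refine (hlog.congr_deriv ?_ ?_).congr_of_eventuallyEq ?_
    · field_simp
    · field_simp
    · filter_upwards [hU.mem_nhds hq] with r hr
      rw [ofReal_log (hpos r hr).le, ofReal_div]
  obtain ⟨α₀, β₀, hg₀, hβ₀⟩ := exists_hasWirtingerDerivAt_gz hU hu hh hμ0 hp k
  obtain ⟨α₁, β₁, hg₁, hβ₁⟩ := exists_hasWirtingerDerivAt_gz hU hu hh hμ0 hp (k + 1)
  have h0 : (gfun l μ u h k p : ℂ) ≠ 0 := ofReal_ne_zero.2 (hne p hp).2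
  have h1 : (gfun l μ u h (k + 1) p : ℂ) ≠ 0 := ofReal_ne_zero.2 (hne p hp).1
  have hd2 := (hg₁.div (hasWirtingerDerivAt_gfun hU hu hh hμ0 hp (k + 1)) h1).sub
    (hg₀.div (hasWirtingerDerivAt_gfun hU hu hh hμ0 hp k) h0)
  have hlap := laplacian_eq_of_hasWirtingerDerivAt
    (f := fun q => ((Real.log (gfun l μ u h (k + 1) q / gfun l μ u h k q) : ℝ) : ℂ))
    (ofRealCLM.contDiff.contDiffAt.comp p hC)
    (Filter.eventually_of_mem (hU.mem_nhds hp) hd1) hd2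
  have hcast := hC.laplacian_CLM_comp_left (l := ofRealCLM)
  rw [← ofReal_inj]
  refine (hcast.symm.trans hlap).trans ?_
  rw [hβ₀, hβ₁, show k + 1 - 1 = k by ring, show k + 1 + 1 = k + 2 by ring]
  push_cast
  rw [sub_eq_add_neg (expo l u (k + 1) p : ℂ), sub_eq_add_neg (expo l u k p : ℂ),
    Complex.exp_add, Complex.exp_add]
  field_simp

end Derivatives

end EllipticToda

/-! ### The Darboux transformation -/

theorem mainTheorem5 (l : ℕ) (hl : 1 ≤ l) (U : Set ℂ) (hU : IsOpen U)
    (u : ℕ → ℂ → ℝ) (hu : EllipticToda.IsTodaSolution l u U)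
    (μ : ℂ) (hμ0 : μ ≠ 0) (hμ1 : ‖μ‖ ≠ 1)
    (h : ZMod (2 * l + 1) → ℂ → ℂ) (hh : EllipticToda.IsLaxSolution l u μ h U)
    (hpos : ∀ p ∈ U, ∀ j ∈ Finset.Icc 1 l,
      0 < EllipticToda.gfun l μ u h ((j : ZMod (2 * l + 1)) + 2) p
        / EllipticToda.gfun l μ u h ((j : ZMod (2 * l + 1)) + 1) p) :
    EllipticToda.IsTodaSolution l
      (fun j p => u j p +
        Real.log (EllipticToda.gfun l μ u h ((j : ZMod (2 * l + 1)) + 2) p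
          / EllipticToda.gfun l μ u h ((j : ZMod (2 * l + 1)) + 1) p)) U := by
  open EllipticToda in
  have hu2 : ∀ j ∈ Finset.Icc 1 l, ContDiffOn ℝ 2 (u j) U := fun j hj => (hu j hj).1
  have hlog : ∀ j ∈ Finset.Icc 1 l, ContDiffOn ℝ 2
      (fun p => Real.log (gfun l μ u h ((j : ZMod (2 * l + 1)) + 2) p
        / gfun l μ u h ((j : ZMod (2 * l + 1)) + 1) p)) U := fun j hj =>
    ((contDiffOn_gfun hU hu2 hh _).div (contDiffOn_gfun hU hu2 hh _) fun q hq =>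
      (div_ne_zero_iff.1 (hpos q hq j hj).ne').2).log fun q hq => (hpos q hq j hj).ne'
  intro j hj
  refine ⟨(hu2 j hj).add (hlog j hj), fun p hp => ?_⟩
  obtain ⟨hj1, hjl⟩ := Finset.mem_Icc.1 hj
  have hlap := laplacian_log_gfun_div hU hu2 hh hμ0 (k := (j : ZMod (2 * l + 1)) + 1)
    (fun q hq => by
      rw [show (j : ZMod (2 * l + 1)) + 1 + 1 = j + 2 by ring]; exact hpos q hq j hj) hp
  simp only [show (j : ZMod (2 * l + 1)) + 1 + 1 = j + 2 by ring,
    show (j : ZMod (2 * l + 1)) + 1 + 2 = j + 3 by ring, add_sub_cancel_right] at hlap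
  have hadd := ContDiffAt.laplacian_add ((hu2 j hj).contDiffAt (hU.mem_nhds hp))
    ((hlog j hj).contDiffAt (hU.mem_nhds hp))
  refine hadd.trans ?_
  rw [hlap, (hu j hj).2 p hp]
  obtain ⟨hne2, hne1⟩ := div_ne_zero_iff.1 (hpos p hp j hj).ne'
  have hwj : expo l u ((j : ZMod (2 * l + 1)) + 1) p = u j p := by
    rw [add_comm]; exact expo_one_add u p hj
  -- The first exponential on the right is `exp (w_k - w_{k-1})` for `k = j + 1`; for `j = 1` the
  -- symmetry `g_{3-k} = g_k` gives `g_1 = g_2`.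
  have hfirst : (if j = 1 then Real.exp (u 1 p) else Real.exp (u j p - u (j - 1) p)) =
        Real.exp (expo l u ((j : ZMod (2 * l + 1)) + 1) p - expo l u j p) ∧
      (if j = 1 then Real.exp (u 1 p + Real.log (gfun l μ u h (((1 : ℕ) : ZMod (2 * l + 1)) + 2) p
          / gfun l μ u h (((1 : ℕ) : ZMod (2 * l + 1)) + 1) p))
        else Real.exp (u j p + Real.log (gfun l μ u h ((j : ZMod (2 * l + 1)) + 2) p
          / gfun l μ u h ((j : ZMod (2 * l + 1)) + 1) p)
          - (u (j - 1) p + Real.log (gfun l μ u h (((j - 1 : ℕ) : ZMod (2 * l + 1)) + 2) p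
          / gfun l μ u h (((j - 1 : ℕ) : ZMod (2 * l + 1)) + 1) p)))) =
        Real.exp (expo l u ((j : ZMod (2 * l + 1)) + 1) p - expo l u j p) *
          (gfun l μ u h ((j : ZMod (2 * l + 1)) + 2) p * gfun l μ u h j p
            / gfun l μ u h ((j : ZMod (2 * l + 1)) + 1) p ^ 2) := by
    rw [hwj]
    split_ifs with h1
    · subst h1
      have hsymm := gfun_three_sub μ u h 1 p
      rw [show (3 : ZMod (2 * l + 1)) - 1 = (1 : ℕ) + 1 by push_cast; ring] at hsymm
      rw [Nat.cast_one, expo_one, sub_zero, Real.exp_add]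
      refine ⟨rfl, ?_⟩
      have hexp := Real.exp_log (hpos p hp 1 hj)
      rw [Nat.cast_one] at hsymm hne1 hexp
      rw [hexp, ← hsymm]
      field_simp
    · obtain ⟨i, rfl⟩ : ∃ i, j = i + 1 := ⟨j - 1, by omega⟩
      have hi : i ∈ Finset.Icc 1 l := Finset.mem_Icc.2 ⟨by omega, by omega⟩
      have hwi : expo l u ((i + 1 : ℕ) : ZMod (2 * l + 1)) p = u i p := by
        rw [Nat.cast_succ, add_comm]; exact expo_one_add u p hi
      obtain ⟨hi2, hi1⟩ := div_ne_zero_iff.1 (hpos p hp i hi).ne'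
      rw [hwi, Nat.add_sub_cancel]
      refine ⟨rfl, ?_⟩
      rw [add_sub_add_comm, Real.exp_add, Real.exp_sub (Real.log _), Real.exp_log (hpos p hp i hi),
        Real.exp_log (hpos p hp (i + 1) hj)]
      have e1 : ((i + 1 : ℕ) : ZMod (2 * l + 1)) + 1 = i + 2 := by push_cast; ring
      have e0 : ((i + 1 : ℕ) : ZMod (2 * l + 1)) = i + 1 := by push_cast; ring
      rw [e1, e0]
      field_simp
  -- Likewise for the second one with `k = j + 2`; for `j = l` the symmetries `w_{l+2} = -w_{l+1}`
  -- and `g_{l+3} = g_{l+1}` enter.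
  have hsecond : (if j = l then Real.exp (-2 * u l p) else Real.exp (u (j + 1) p - u j p)) =
        Real.exp (expo l u ((j : ZMod (2 * l + 1)) + 2) p
          - expo l u ((j : ZMod (2 * l + 1)) + 1) p) ∧
      (if j = l then Real.exp (-2 * (u l p + Real.log (gfun l μ u h ((l : ZMod (2 * l + 1)) + 2) p
          / gfun l μ u h ((l : ZMod (2 * l + 1)) + 1) p)))
        else Real.exp (u (j + 1) p + Real.log (gfun l μ u h (((j + 1 : ℕ) : ZMod (2 * l + 1)) + 2) p
          / gfun l μ u h (((j + 1 : ℕ) : ZMod (2 * l + 1)) + 1) p)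
          - (u j p + Real.log (gfun l μ u h ((j : ZMod (2 * l + 1)) + 2) p
          / gfun l μ u h ((j : ZMod (2 * l + 1)) + 1) p)))) =
        Real.exp (expo l u ((j : ZMod (2 * l + 1)) + 2) p
          - expo l u ((j : ZMod (2 * l + 1)) + 1) p) *
          (gfun l μ u h ((j : ZMod (2 * l + 1)) + 3) p
            * gfun l μ u h ((j : ZMod (2 * l + 1)) + 1) p
            / gfun l μ u h ((j : ZMod (2 * l + 1)) + 2) p ^ 2) := by
    rw [hwj]
    split_ifs with h1
    · subst h1
      have hN : (2 * j + 1 : ZMod (2 * j + 1)) = 0 := by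
        exact_mod_cast ZMod.natCast_self (2 * j + 1)
      have hw := expo_two_sub u p ((j : ZMod (2 * j + 1)) + 1)
      rw [show (2 : ZMod (2 * j + 1)) - (j + 1) = j + 2 by linear_combination -hN, hwj] at hw
      have hg := gfun_three_sub μ u h ((j : ZMod (2 * j + 1)) + 1) p
      rw [show (3 : ZMod (2 * j + 1)) - (j + 1) = j + 3 by linear_combination -hN] at hg
      rw [hw, hg, show -u j p - u j p = -2 * u j p by ring]
      refine ⟨rfl, ?_⟩
      rw [mul_add, Real.exp_add, show ∀ x : ℝ, -2 * x = -(x + x) by intro x; ring,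
        show ∀ x : ℝ, -2 * x = -(x + x) by intro x; ring,
        Real.exp_neg (Real.log _ + _), Real.exp_add (Real.log _), Real.exp_log (hpos p hp j hj)]
      field_simp
    · have hi : j + 1 ∈ Finset.Icc 1 l := Finset.mem_Icc.2 ⟨by omega, by omega⟩
      have e2 : ((j + 1 : ℕ) : ZMod (2 * l + 1)) + 2 = j + 3 := by push_cast; ring
      have e1 : ((j + 1 : ℕ) : ZMod (2 * l + 1)) + 1 = j + 2 := by push_cast; ring
      have hwi : expo l u ((j : ZMod (2 * l + 1)) + 2) p = u (j + 1) p := by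
        rw [← e1, add_comm]; exact expo_one_add u p hi
      rw [hwi]
      refine ⟨rfl, ?_⟩
      rw [add_sub_add_comm, Real.exp_add, Real.exp_sub (Real.log _), Real.exp_log (hpos p hp j hj),
        Real.exp_log (hpos p hp (j + 1) hi), e2, e1]
      field_simp
  rw [hfirst.1, hfirst.2, hsecond.1, hsecond.2]
  ring
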